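/- Let $m,r,n_1,\dots,n_m$ be positive integers, let $\tau_0,\tau_1$ be non-negative integers, and put $N=n_1+\dots+n_m$. Suppose that $$N-n_m+\tau_1+(m-1)\le\tau_0\le N+\tau_1+(m-1).$$ Let $\gamma$ be Euler's constant, let $S_q=\sum_{k=1}^{q}\frac1k-\log(q+1)$ for integers $q\ge 0$, and let $$\omega(t)=\frac{1}{t\left(\log^2(1/t-1)+\pi^2\right)}\qquad(0<t<1).$$ Then $$\left|\gamma-\frac{n_1!\cdots n_m!}{N!\,(-r)^N}\sum_{k=0}^N(-1)^k\binom{N}{k}\prod_{j=1}^m\binom{rk+n_1+\dots+n_j+\tau_1+j-1}{n_j}\;S_{rk+\tau_0}\right|$$ $$\le\prod_{j=1}^{m-1}\frac{N+j}{n_{j+1}+\dots+n_m+m-j}\;\int_0^1\!\!\int_0^1\frac{x^{N+\tau_1+m-1}(1-x^r)^N\,t^{N+\tau_1+m-1-\tau_0}(1-t)^{\tau_0+n_m-N-\tau_1-m+1}\,\omega(t)}{r^N(1-t+xt)^{n_m+1}}\,dx\,dt,$$ where the integrand on the right is integrable over $[0,1]^2$. -/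

import Mathlib

/-- The weight `ω(t) = 1 / (t (log²(1/t - 1) + π²))`. -/
noncomputable def eulerWeight (t : ℝ) : ℝ :=
  1 / (t * (Real.log (1 / t - 1) ^ 2 + Real.pi ^ 2))

/-- The integrand of the double integral (in the variables `x`, `t`), where `N`, `l = n_m`, `m`,
`r`, `τ₀`, `τ₁` are the parameters. The natural number subtractions in the exponents are genuine
subtractions as soon as `N - l + τ₁ + (m - 1) ≤ τ₀ ≤ N + τ₁ + (m - 1)` and `1 ≤ m`. -/
noncomputable def eulerIntegrand (N l m r τ₀ τ₁ : ℕ) (x t : ℝ) : ℝ :=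
  x ^ (N + τ₁ + m - 1) * (1 - x ^ r) ^ N * t ^ (N + τ₁ + m - 1 - τ₀) *
      (1 - t) ^ (τ₀ + l + 1 - (N + τ₁ + m)) * eulerWeight t /
    ((r : ℝ) ^ N * (1 - t + x * t) ^ (l + 1))

/-! The proof rests on an integral for the error, γ - S_q = ∬ x^q ω(t)/(1-t+xt) dx dt
(`integral_pow_mul_eulerWeight_div`). The coefficients a_k of the alternating sum, written with
falling factorials, add up to N!(-r)^N, because they form an N-th finite difference of a polynomial
of degree N (`sum_alternating_prod_descFactorial`). Hence the quantity inside the absolute value is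
a normalised double integral of ω(t)/(1-t+xt) against ∑ a_k x^(rk+τ₀).

That sum equals x^A (D^{n_1} U_1)(x) with A = τ₀ - τ₁. Here U_m = x^(N+τ₁+m-1)(1-x^r)^N and
D^{n_{j+1}} U_{j+1} = x U_j. For fixed t put c = t/(1-t) and z = 1+cx, so that x^A/(1-t+xt) is a
multiple of (z-1)^A/z. Integration by parts moves each block of n_j derivatives onto this Laurent
polynomial in z; the zeros of U_j at 0 and 1 remove the boundary terms. Between blocks one factor
z-1 = cx is given back to U_j, which makes it D^{n_{j+1}} U_{j+1} (`exists_laurent_chain`).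

After the last block the upper bound on A leaves only negative powers of z. Their size is controlled
by `principalNorm`, a weighted norm for which differentiation is an exact shift of the weight and
division by z-1 costs at most a factor 1/(M+1). These factors make up the product in the bound
(`abs_integral_chain_le`). Integrating over t finishes the proof. -/

open Polynomial

/-! ### Laurent polynomials: principal parts, derivatives and division by z - 1. -/

/-- The weighted `ℓ¹` norm `∑_{k ≥ 1} |c_{-k}| k (k + 1) ⋯ (k + M - 1)` of the principal part of the
Laurent polynomial `R(z) / z ^ K = ∑ c_k z ^ k`. -/
noncomputable def principalNorm (R : ℝ[X]) (K M : ℕ) : ℝ :=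
  ∑ i ∈ Finset.range K, |R.coeff i| * ((K - i).ascFactorial M : ℝ)

/-- The numerator of the derivative of `R(z) / z ^ K` over the denominator `z ^ (K + 1)`. -/
noncomputable def laurentDeriv (K : ℕ) (R : ℝ[X]) : ℝ[X] :=
  derivative R * X - C (K : ℝ) * R

/-- The numerator of the `n`-th derivative of `R(z) / z ^ K` over the denominator `z ^ (K + n)`. -/
noncomputable def laurentDerivIter (K : ℕ) (R : ℝ[X]) : ℕ → ℝ[X]
  | 0 => R
  | n + 1 => laurentDeriv (K + n) (laurentDerivIter K R n)

theorem Nat.ascFactorial_succ_eq_self_mul (n k : ℕ) :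
    n.ascFactorial (k + 1) = n * (n + 1).ascFactorial k := by
  rw [Nat.ascFactorial_succ, ← Nat.succ_ascFactorial]

theorem coeff_laurentDeriv (K : ℕ) (R : ℝ[X]) (i : ℕ) :
    (laurentDeriv K R).coeff i = ((i : ℝ) - K) * R.coeff i := by
  unfold laurentDeriv
  rw [coeff_sub, coeff_C_mul]
  cases i with
  | zero => simp
  | succ i => rw [coeff_mul_X, coeff_derivative]; push_cast; ring

/-- Differentiation sends z^(-k) to -k z^(-k-1), and k times the weight (k+1)⋯(k+M) is the weight
k(k+1)⋯(k+M). The new index `K` carries the derivative of a constant, so it contributes nothing. -/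
theorem principalNorm_laurentDeriv (R : ℝ[X]) (K M : ℕ) :
    principalNorm (laurentDeriv K R) (K + 1) M = principalNorm R K (M + 1) := by
  unfold principalNorm
  rw [Finset.sum_range_succ]
  simp only [coeff_laurentDeriv, sub_self, zero_mul, abs_zero, add_zero]
  refine Finset.sum_congr rfl fun i hi => ?_
  have hi : i < K := Finset.mem_range.1 hi
  obtain ⟨d, rfl⟩ := Nat.exists_eq_add_of_lt hi
  have h1 : i + d + 1 + 1 - i = d + 1 + 1 := by omega
  have h2 : i + d + 1 - i = d + 1 := by omega
  rw [h1, h2, abs_mul, Nat.ascFactorial_succ_eq_self_mul (d + 1), Nat.cast_mul]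
  have h3 : |(i : ℝ) - ((i + d + 1 : ℕ) : ℝ)| = d + 1 := by
    rw [show (i : ℝ) - ((i + d + 1 : ℕ) : ℝ) = -((d : ℝ) + 1) by push_cast; ring, abs_neg,
      abs_of_nonneg (by positivity)]
  rw [h3]
  push_cast
  ring

theorem principalNorm_laurentDerivIter (R : ℝ[X]) (K n M : ℕ) :
    principalNorm (laurentDerivIter K R n) (K + n) M = principalNorm R K (M + n) := by
  induction n generalizing M with
  | zero => rfl
  | succ n ih =>
    rw [laurentDerivIter, ← add_assoc, principalNorm_laurentDeriv, ih]
    congr 1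
    ring

/-- Summation by parts: consecutive coefficients of S differ by a coefficient of R, while
consecutive weights of order M+1 differ by M+1 times a weight of order M. -/
theorem principalNorm_le_of_eq_X_sub_one_mul {R S : ℝ[X]} (h : R = (X - 1) * S) (K M : ℕ) :
    principalNorm S K M ≤ principalNorm R K (M + 1) / (M + 1) := by
  have hR : ∀ i, |S.coeff i| ≤ |R.coeff i| + |(X * S).coeff i| := by
    intro i
    have : S.coeff i = (X * S).coeff i - R.coeff i := by
      rw [h, sub_mul, one_mul, coeff_sub]; ring
    rw [this, add_comm]
    exact abs_sub _ _
  -- The partial sums carry a boundary term whose weight is `(K - k).ascFactorial (M + 1)`; it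
  -- vanishes at `k = K`.
  have key : ∀ k ≤ K, (M + 1) * ∑ i ∈ Finset.range k, |S.coeff i| * ((K - i).ascFactorial M : ℝ)
      + |(X * S).coeff k| * ((K - k).ascFactorial (M + 1) : ℝ) ≤
      ∑ i ∈ Finset.range k, |R.coeff i| * ((K - i).ascFactorial (M + 1) : ℝ) := by
    intro k hk
    induction k with
    | zero => simp
    | succ k ih =>
      rw [Finset.sum_range_succ, Finset.sum_range_succ, coeff_X_mul]
      have ih' := ih (by omega)
      obtain ⟨d, rfl⟩ := Nat.exists_eq_add_of_lt hk
      have h1 : k + d + 1 - k = d + 1 := by omega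
      have h2 : k + d + 1 - (k + 1) = d := by omega
      rw [h1] at ih' ⊢
      rw [h2]
      have h3 : ((d + 1).ascFactorial (M + 1) : ℝ) =
          (M + 1) * ((d + 1).ascFactorial M : ℝ) + (d.ascFactorial (M + 1) : ℝ) := by
        rw [Nat.ascFactorial_succ_eq_self_mul d M, Nat.ascFactorial_succ]
        push_cast
        ring
      have h4 := mul_le_mul_of_nonneg_right (hR k)
        (Nat.cast_nonneg (α := ℝ) ((d + 1).ascFactorial (M + 1)))
      rw [h3] at h4 ih' ⊢
      linarith
  have := key K le_rfl
  rw [Nat.sub_self] at this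
  rw [le_div_iff₀ (by positivity)]
  unfold principalNorm
  rw [Nat.zero_ascFactorial] at this
  push_cast at this
  linarith

theorem coeff_laurentDerivIter_eq_zero {R : ℝ[X]} {K d n : ℕ}
    (h : ∀ i, K + d ≤ i → R.coeff i = 0) :
    ∀ i, K + n + (d - n) ≤ i → (laurentDerivIter K R n).coeff i = 0 := by
  induction n with
  | zero => simpa [laurentDerivIter] using h
  | succ n ih =>
    intro i hi
    rw [laurentDerivIter, coeff_laurentDeriv]
    by_cases hi' : i = K + n
    · omega
    · rw [ih i (by omega), mul_zero]

/-- The index i keeps following the original power z^(i-K), and each derivative multiplies by the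
current exponent. For K ≤ i < K+n one of these factors is 0: n derivatives kill a polynomial part of
degree below n and create no power from z^(-1) to z^(-n). -/
theorem coeff_laurentDerivIter_eq_zero_of_le {R : ℝ[X]} {K d n : ℕ} (hd : d ≤ n)
    (h : ∀ i, K + d ≤ i → R.coeff i = 0) :
    ∀ i, K ≤ i → (laurentDerivIter K R n).coeff i = 0 := by
  have aux : ∀ n i, K ≤ i → (K + d ≤ i ∨ i < K + n) → (laurentDerivIter K R n).coeff i = 0 := by
    intro n
    induction n with
    | zero =>
      rintro i hi (h1 | h1)
      · exact h i h1
      · omega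
    | succ n ih =>
      intro i hi hin
      rw [laurentDerivIter, coeff_laurentDeriv]
      by_cases hi' : i = K + n
      · rw [hi']; simp
      · rw [ih i hi (by omega), mul_zero]
  intro i hi
  exact aux n i hi (by omega)

theorem pow_dvd_laurentDeriv {P R : ℝ[X]} {a K : ℕ} (h : P ^ a ∣ R) :
    P ^ (a - 1) ∣ laurentDeriv K R := by
  unfold laurentDeriv
  refine dvd_sub ((pow_sub_one_dvd_derivative_of_pow_dvd h).mul_right _) ?_
  exact ((pow_dvd_pow P (Nat.sub_le a 1)).trans h).mul_left _

theorem pow_dvd_laurentDerivIter {P R : ℝ[X]} {a K : ℕ} (h : P ^ a ∣ R) (n : ℕ) :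
    P ^ (a - n) ∣ laurentDerivIter K R n := by
  induction n with
  | zero => simpa [laurentDerivIter] using h
  | succ n ih => exact pow_dvd_laurentDeriv ih

/-! ### Integration by parts against a Laurent polynomial in 1 + cx. -/

theorem hasDerivAt_laurent (R : ℝ[X]) (K : ℕ) (c x : ℝ) (h : 1 + c * x ≠ 0) :
    HasDerivAt (fun x => R.eval (1 + c * x) / (1 + c * x) ^ K)
      (c * ((laurentDeriv K R).eval (1 + c * x) / (1 + c * x) ^ (K + 1))) x := by
  have h1 : HasDerivAt (fun x : ℝ => 1 + c * x) c x := by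
    simpa using ((hasDerivAt_id x).const_mul c).const_add 1
  have h2 := (R.hasDerivAt (1 + c * x)).comp x h1
  have h3 := h2.div (h1.pow K) (pow_ne_zero K h)
  refine h3.congr_deriv ?_
  simp only [laurentDeriv, eval_sub, eval_mul, eval_X, eval_C, Function.comp, Pi.pow_apply]
  cases K with
  | zero => field_simp; simp; ring
  | succ K =>
    field_simp
    simp only [Nat.add_sub_cancel]
    push_cast
    ring

theorem continuousOn_laurent (R : ℝ[X]) (K : ℕ) {c : ℝ} (hc : 0 ≤ c) :
    ContinuousOn (fun x => R.eval (1 + c * x) / (1 + c * x) ^ K) (Set.uIcc 0 1) := by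
  intro x hx
  rw [Set.uIcc_of_le zero_le_one] at hx
  have : (0 : ℝ) < 1 + c * x := by have := mul_nonneg hc hx.1; linarith
  exact (hasDerivAt_laurent R K c x this.ne').continuousAt.continuousWithinAt

theorem integral_iterate_derivative_mul_laurent (n : ℕ) (U R : ℝ[X]) (K : ℕ) {c : ℝ} (hc : 0 ≤ c)
    (h0 : X ^ n ∣ U) (h1 : (X - 1) ^ n ∣ U) :
    ∫ x in (0 : ℝ)..1, (derivative^[n] U).eval x * (R.eval (1 + c * x) / (1 + c * x) ^ K) =
      (-c) ^ n * ∫ x in (0 : ℝ)..1,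
        U.eval x * ((laurentDerivIter K R n).eval (1 + c * x) / (1 + c * x) ^ (K + n)) := by
  induction n generalizing U with
  | zero => simp [laurentDerivIter]
  | succ n ih =>
    rw [Function.iterate_succ_apply, ih _ (by simpa using pow_sub_one_dvd_derivative_of_pow_dvd h0)
      (by simpa using pow_sub_one_dvd_derivative_of_pow_dvd h1)]
    set S := laurentDerivIter K R n with hS
    have hu0 : U.eval 0 = 0 := by
      obtain ⟨q, rfl⟩ := h0
      simp
    have hu1 : U.eval 1 = 0 := by
      obtain ⟨q, rfl⟩ := h1
      simp
    have ibp := intervalIntegral.integral_mul_deriv_eq_deriv_mul (a := 0) (b := 1)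
      (u := fun x => S.eval (1 + c * x) / (1 + c * x) ^ (K + n)) (v := fun x => U.eval x)
      (u' := fun x => c * ((laurentDeriv (K + n) S).eval (1 + c * x) / (1 + c * x) ^ (K + n + 1)))
      (v' := fun x => (derivative U).eval x)
      (fun x hx => by
        rw [Set.uIcc_of_le zero_le_one] at hx
        have : (0 : ℝ) < 1 + c * x := by have := mul_nonneg hc hx.1; linarith
        exact hasDerivAt_laurent S (K + n) c x this.ne')
      (fun x _ => U.hasDerivAt x)
      ((continuousOn_const.mul (continuousOn_laurent _ _ hc)).intervalIntegrable)
      ((derivative U).continuous.intervalIntegrable 0 1)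
    simp only [hu0, hu1, mul_zero, sub_self, zero_sub] at ibp
    rw [show (fun x => eval x (derivative U) * (eval (1 + c * x) S / (1 + c * x) ^ (K + n))) =
      fun x => (eval (1 + c * x) S / (1 + c * x) ^ (K + n)) * eval x (derivative U) from
      funext fun x => mul_comm _ _, ibp]
    have : ∀ x : ℝ, c * (eval (1 + c * x) (laurentDeriv (K + n) S) / (1 + c * x) ^ (K + n + 1)) *
        eval x U = c * (eval x U * (eval (1 + c * x) (laurentDeriv (K + n) S) /
          (1 + c * x) ^ (K + n + 1))) := fun x => by ring
    simp only [this, intervalIntegral.integral_const_mul]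
    rw [laurentDerivIter, ← hS, ← add_assoc]
    ring

/-! ### The double integral for γ - S_q. -/

section
open MeasureTheory Set

theorem image_one_div_one_add_Ioi :
    (fun v : ℝ => 1 / (1 + v)) '' Ioi 0 = Ioo 0 1 := by
  ext t
  constructor
  · rintro ⟨v, hv, rfl⟩
    have hv : 0 < v := hv
    exact ⟨by positivity, (div_lt_one (by positivity)).2 (by linarith)⟩
  · rintro ⟨h0, h1⟩
    refine ⟨1 / t - 1, ?_, by simp⟩
    have := (one_lt_div h0).2 h1
    simp only [mem_Ioi]
    linarith

theorem setLIntegral_Ioo_eq_setLIntegral_Ioi (g : ℝ → ENNReal) :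
    ∫⁻ t in Ioo (0 : ℝ) 1, g t =
      ∫⁻ v in Ioi (0 : ℝ), ENNReal.ofReal (1 / (1 + v) ^ 2) * g (1 / (1 + v)) := by
  rw [← image_one_div_one_add_Ioi, lintegral_image_eq_lintegral_abs_deriv_mul
    (f' := fun v => -(1 / (1 + v) ^ 2)) measurableSet_Ioi]
  · simp only [abs_neg]
    refine setLIntegral_congr_fun measurableSet_Ioi fun v (hv : 0 < v) => ?_
    rw [abs_of_nonneg (by positivity)]
  · intro v hv
    have hv : 0 < v := hv
    have := ((hasDerivAt_id v).const_add 1).inv (by simp only [id]; positivity)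
    simp only [one_div]
    refine (this.congr_deriv ?_).hasDerivWithinAt
    simp [neg_div]
  · intro v hv w hw h
    have hv : 0 < v := hv
    have hw : 0 < w := hw
    simp only [one_div, inv_inj] at h
    linarith

/-- Under t = 1/(1+v) this is the beta integral B(1-s, s), known from the total mass of the beta
distribution, combined with the reflection formula for Γ. -/
theorem lintegral_rpow_div_one_add {s : ℝ} (h0 : 0 < s) (h1 : s < 1) :
    ∫⁻ v in Ioi (0 : ℝ), ENNReal.ofReal (v ^ (s - 1) / (1 + v)) =
      ENNReal.ofReal (Real.pi / Real.sin (Real.pi * s)) := by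
  have h1s : 0 < 1 - s := by linarith
  have hb : ProbabilityTheory.beta (1 - s) s = Real.pi / Real.sin (Real.pi * s) := by
    rw [ProbabilityTheory.beta, sub_add_cancel, Real.Gamma_one, div_one, mul_comm,
      Real.Gamma_mul_Gamma_one_sub]
  have hpos := ProbabilityTheory.beta_pos h1s h0
  have key := ProbabilityTheory.lintegral_betaPDF_eq_one h1s h0
  rw [ProbabilityTheory.lintegral_betaPDF, setLIntegral_Ioo_eq_setLIntegral_Ioi] at key
  rw [← hb]
  have : ∀ v ∈ Ioi (0 : ℝ), ENNReal.ofReal (1 / (1 + v) ^ 2) *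
      ENNReal.ofReal (1 / ProbabilityTheory.beta (1 - s) s * (1 / (1 + v)) ^ (1 - s - 1) *
        (1 - 1 / (1 + v)) ^ (s - 1)) = ENNReal.ofReal (1 / ProbabilityTheory.beta (1 - s) s) *
        ENNReal.ofReal (v ^ (s - 1) / (1 + v)) := by
    intro v hv
    have hv : 0 < v := hv
    have hv1 : 0 < 1 + v := by positivity
    rw [← ENNReal.ofReal_mul (by positivity), ← ENNReal.ofReal_mul (by positivity)]
    congr 1
    have e1 : 1 - 1 / (1 + v) = v / (1 + v) := by field_simp; ring
    have e2 : (1 / (1 + v)) ^ (1 - s - 1) = (1 + v) ^ s := by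
      rw [one_div, Real.inv_rpow hv1.le, ← Real.rpow_neg hv1.le]
      congr 1
      ring
    rw [e1, e2, Real.div_rpow hv.le hv1.le, Real.rpow_sub_one hv1.ne']
    have := Real.rpow_pos_of_pos hv1 s
    field_simp
  rw [setLIntegral_congr_fun measurableSet_Ioi this, lintegral_const_mul' _ _ (by simp)] at key
  rw [one_div, ENNReal.ofReal_inv_of_pos hpos] at key
  have h2 := congrArg (ENNReal.ofReal (ProbabilityTheory.beta (1 - s) s) * ·) key
  simp only [mul_one] at h2
  rwa [← mul_assoc, ENNReal.mul_inv_cancel (by simpa using hpos) (by simp), one_mul] at h2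

theorem lintegral_rpow_mul_div_add {s x : ℝ} (h0 : 0 < s) (h1 : s < 1) (hx : 0 < x) :
    ∫⁻ v in Ioi (0 : ℝ), ENNReal.ofReal (v ^ (s - 1) * x / (v + x)) =
      ENNReal.ofReal (Real.pi / Real.sin (Real.pi * s) * x ^ s) := by
  have him : (fun v : ℝ => x * v) '' Ioi 0 = Ioi 0 := by
    rw [image_mul_left_Ioi hx, mul_zero]
  nth_rw 1 [← him]
  rw [lintegral_image_eq_lintegral_abs_deriv_mul (f' := fun _ => x) measurableSet_Ioi
    (fun v _ => by simpa using ((hasDerivAt_id v).const_mul x).hasDerivWithinAt)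
    (mul_right_injective₀ hx.ne').injOn]
  have : ∀ v ∈ Ioi (0 : ℝ), ENNReal.ofReal |x| *
      ENNReal.ofReal ((x * v) ^ (s - 1) * x / (x * v + x)) =
        ENNReal.ofReal (x ^ s) * ENNReal.ofReal (v ^ (s - 1) / (1 + v)) := by
    intro v hv
    have hv : 0 < v := hv
    rw [← ENNReal.ofReal_mul (by positivity), ← ENNReal.ofReal_mul (by positivity)]
    congr 1
    rw [abs_of_pos hx, Real.mul_rpow hx.le hv.le, Real.rpow_sub_one hx.ne']
    field_simp
    ring
  rw [setLIntegral_congr_fun measurableSet_Ioi this, lintegral_const_mul' _ _ (by simp),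
    lintegral_rpow_div_one_add h0 h1, ← ENNReal.ofReal_mul (by positivity), mul_comm]

theorem sin_pi_mul_pos {s : ℝ} (h0 : 0 < s) (h1 : s < 1) : 0 < Real.sin (Real.pi * s) :=
  Real.sin_pos_of_pos_of_lt_pi (by positivity) (by nlinarith [Real.pi_pos])

/-- Partial fractions, from x(1+v) + (1-x)v = v+x, reduce this to the two preceding integrals. The
identity is kept additive and finite terms are cancelled, since the integrals live in `ENNReal`. -/
theorem lintegral_rpow_div_mul {s x : ℝ} (h0 : 0 < s) (h1 : s < 1) (hx : 0 < x) (hx1 : x < 1) :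
    ∫⁻ v in Ioi (0 : ℝ), ENNReal.ofReal (v ^ s / ((v + x) * (1 + v))) =
      ENNReal.ofReal (Real.pi / Real.sin (Real.pi * s) * ((1 - x ^ s) / (1 - x))) := by
  have hx' : 0 < 1 - x := by linarith
  have hB : 0 < Real.pi / Real.sin (Real.pi * s) := div_pos Real.pi_pos (sin_pi_mul_pos h0 h1)
  have hsplit : ∀ v ∈ Ioi (0 : ℝ), ENNReal.ofReal (v ^ (s - 1) / (1 + v)) =
      ENNReal.ofReal (v ^ (s - 1) * x / (v + x)) +
        ENNReal.ofReal (1 - x) * ENNReal.ofReal (v ^ s / ((v + x) * (1 + v))) := by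
    intro v hv
    have hv : 0 < v := hv
    rw [← ENNReal.ofReal_mul (by positivity), ← ENNReal.ofReal_add (by positivity) (by positivity)]
    congr 1
    rw [Real.rpow_sub_one hv.ne']
    field_simp
    ring
  have key := lintegral_rpow_div_one_add h0 h1
  rw [setLIntegral_congr_fun measurableSet_Ioi hsplit, lintegral_add_left (by fun_prop),
    lintegral_const_mul' _ _ (by simp), lintegral_rpow_mul_div_add h0 h1 hx] at key
  have hle : x ^ s ≤ 1 := Real.rpow_le_one hx.le hx1.le h0.le
  have e : ENNReal.ofReal (Real.pi / Real.sin (Real.pi * s)) =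
      ENNReal.ofReal (Real.pi / Real.sin (Real.pi * s) * x ^ s) + ENNReal.ofReal (1 - x) *
        ENNReal.ofReal (Real.pi / Real.sin (Real.pi * s) * ((1 - x ^ s) / (1 - x))) := by
    have : 0 ≤ 1 - x ^ s := by linarith
    rw [← ENNReal.ofReal_mul (by positivity), ← ENNReal.ofReal_add (by positivity) (by positivity)]
    congr 1
    field_simp
    ring
  rw [e] at key
  have k2 := (ENNReal.add_right_inj (by simp)).1 key
  exact (ENNReal.mul_right_inj (by simpa using hx1) (by simp)).1 k2

/-- This writes the logarithmic weight as a superposition of powers v^s, against which the rational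
kernel can be integrated explicitly. -/
theorem integral_sin_mul_rpow {v : ℝ} (hv : 0 < v) :
    ∫ s in (0 : ℝ)..1, Real.sin (Real.pi * s) * v ^ s =
      Real.pi * (1 + v) / (Real.log v ^ 2 + Real.pi ^ 2) := by
  set a := Real.log v with ha
  have hd : a ^ 2 + Real.pi ^ 2 ≠ 0 := by have := Real.pi_pos; positivity
  have hderiv : ∀ s : ℝ, HasDerivAt
      (fun s => Real.exp (a * s) * (a * Real.sin (Real.pi * s) - Real.pi * Real.cos (Real.pi * s)) /
        (a ^ 2 + Real.pi ^ 2)) (Real.sin (Real.pi * s) * v ^ s) s := by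
    intro s
    have h1 : HasDerivAt (fun s : ℝ => a * s) a s := by simpa using (hasDerivAt_id s).const_mul a
    have h2 : HasDerivAt (fun s : ℝ => Real.pi * s) Real.pi s := by
      simpa using (hasDerivAt_id s).const_mul Real.pi
    refine (((h1.exp).mul ((h2.sin.const_mul a).sub
      (h2.cos.const_mul Real.pi))).div_const _).congr_deriv ?_
    rw [Real.rpow_def_of_pos hv, ← ha]
    field_simp
    simp only [Pi.sub_apply]
    ring_nf
  rw [intervalIntegral.integral_eq_sub_of_hasDerivAt (fun s _ => hderiv s)]
  · simp [ha, Real.exp_log hv]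
    field_simp
    ring
  · refine Continuous.intervalIntegrable ?_ _ _
    exact (by fun_prop : Continuous fun s : ℝ => Real.sin (Real.pi * s)).mul
      (Real.continuous_const_rpow hv.ne')

theorem ofReal_one_div_log_sq_add {v x : ℝ} (hv : 0 < v) (hx : 0 < x) :
    ENNReal.ofReal (1 / ((Real.log v ^ 2 + Real.pi ^ 2) * (v + x))) =
      ∫⁻ s in Ioo (0 : ℝ) 1, ENNReal.ofReal
        (Real.sin (Real.pi * s) / Real.pi) * ENNReal.ofReal (v ^ s / ((v + x) * (1 + v))) := by
  have hpi := Real.pi_pos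
  have hcont : Continuous fun s : ℝ => Real.sin (Real.pi * s) * v ^ s :=
    (by fun_prop : Continuous fun s : ℝ => Real.sin (Real.pi * s)).mul
      (Real.continuous_const_rpow hv.ne')
  have h := integral_sin_mul_rpow hv
  rw [intervalIntegral.integral_of_le zero_le_one, integral_Ioc_eq_integral_Ioo] at h
  have hnn : ∀ᵐ s ∂(volume.restrict (Ioo (0 : ℝ) 1)), 0 ≤ Real.sin (Real.pi * s) * v ^ s :=
    ae_restrict_of_forall_mem measurableSet_Ioo fun s hs =>
      mul_nonneg (sin_pi_mul_pos hs.1 hs.2).le (Real.rpow_nonneg hv.le s)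
  have hint : IntegrableOn (fun s : ℝ => Real.sin (Real.pi * s) * v ^ s) (Ioo 0 1) :=
    (hcont.integrableOn_Icc (a := 0) (b := 1)).mono_set Ioo_subset_Icc_self
  have h2 := ofReal_integral_eq_lintegral_ofReal hint hnn
  rw [h] at h2
  have h3 : ∀ s ∈ Ioo (0 : ℝ) 1, ENNReal.ofReal
      (Real.sin (Real.pi * s) / Real.pi) * ENNReal.ofReal (v ^ s / ((v + x) * (1 + v))) =
      ENNReal.ofReal (1 / (Real.pi * ((v + x) * (1 + v)))) *
        ENNReal.ofReal (Real.sin (Real.pi * s) * v ^ s) := by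
    intro s hs
    have := sin_pi_mul_pos hs.1 hs.2
    rw [← ENNReal.ofReal_mul (by positivity), ← ENNReal.ofReal_mul (by positivity)]
    congr 1
    field_simp
  rw [setLIntegral_congr_fun measurableSet_Ioo h3, lintegral_const_mul' _ _ (by simp), ← h2,
    ← ENNReal.ofReal_mul (by positivity)]
  congr 1
  field_simp

theorem eulerWeight_one_div_one_add {v : ℝ} (hv : 0 < v) :
    eulerWeight (1 / (1 + v)) = (1 + v) / (Real.log v ^ 2 + Real.pi ^ 2) := by
  unfold eulerWeight
  rw [one_div_one_div, add_sub_cancel_left]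
  field_simp

theorem eulerWeight_nonneg {t : ℝ} (ht : 0 ≤ t) : 0 ≤ eulerWeight t := by
  unfold eulerWeight
  positivity

@[fun_prop]
theorem measurable_eulerWeight : Measurable eulerWeight := by
  unfold eulerWeight
  fun_prop

/-- Substitute v = 1/t - 1, expand the weight in powers v^s and apply Tonelli; the factor sin(πs)/π
cancels the value π/sin(πs) of the v-integral. -/
theorem lintegral_eulerWeight_div {x : ℝ} (hx : 0 < x) (hx1 : x < 1) :
    ∫⁻ t in Ioo (0 : ℝ) 1, ENNReal.ofReal (eulerWeight t / (1 - t + x * t)) =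
      ∫⁻ s in Ioo (0 : ℝ) 1, ENNReal.ofReal ((1 - x ^ s) / (1 - x)) := by
  have hpi := Real.pi_pos
  rw [setLIntegral_Ioo_eq_setLIntegral_Ioi]
  have h1 : ∀ v ∈ Ioi (0 : ℝ), ENNReal.ofReal (1 / (1 + v) ^ 2) * ENNReal.ofReal
      (eulerWeight (1 / (1 + v)) / (1 - 1 / (1 + v) + x * (1 / (1 + v)))) =
      ∫⁻ s in Ioo (0 : ℝ) 1, ENNReal.ofReal
        (Real.sin (Real.pi * s) / Real.pi) * ENNReal.ofReal (v ^ s / ((v + x) * (1 + v))) := by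
    intro v hv
    have hv : 0 < v := hv
    rw [← ofReal_one_div_log_sq_add hv hx, eulerWeight_one_div_one_add hv,
      ← ENNReal.ofReal_mul (by positivity)]
    congr 1
    have : 1 - 1 / (1 + v) + x * (1 / (1 + v)) = (v + x) / (1 + v) := by
      field_simp
      ring
    rw [this]
    field_simp
  rw [setLIntegral_congr_fun measurableSet_Ioi h1, lintegral_lintegral_swap (by fun_prop)]
  refine setLIntegral_congr_fun measurableSet_Ioo fun s hs => ?_
  have hsin := sin_pi_mul_pos hs.1 hs.2
  rw [lintegral_const_mul' _ _ (by simp), lintegral_rpow_div_mul hs.1 hs.2 hx hx1,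
    ← ENNReal.ofReal_mul (by positivity)]
  congr 1
  field_simp

theorem lintegral_eulerWeight_div_le_one {x : ℝ} (hx : 0 < x) (hx1 : x < 1) :
    ∫⁻ t in Ioo (0 : ℝ) 1, ENNReal.ofReal (eulerWeight t / (1 - t + x * t)) ≤ 1 := by
  rw [lintegral_eulerWeight_div hx hx1]
  calc _ ≤ ∫⁻ _ in Ioo (0 : ℝ) 1, (1 : ENNReal) := by
        refine setLIntegral_mono measurable_const fun s hs => ?_
        rw [ENNReal.ofReal_le_one, div_le_one (by linarith)]
        have := Real.rpow_le_rpow_of_exponent_ge hx hx1.le hs.2.le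
        rw [Real.rpow_one] at this
        linarith
    _ = 1 := by simp

theorem setLIntegral_eq_ofReal_intervalIntegral {f : ℝ → ℝ} (hf : ContinuousOn f (Icc 0 1))
    (h0 : ∀ x ∈ Ioo (0 : ℝ) 1, 0 ≤ f x) :
    ∫⁻ x in Ioo (0 : ℝ) 1, ENNReal.ofReal (f x) = ENNReal.ofReal (∫ x in (0 : ℝ)..1, f x) := by
  rw [intervalIntegral.integral_of_le zero_le_one, integral_Ioc_eq_integral_Ioo,
    ofReal_integral_eq_lintegral_ofReal (hf.integrableOn_Icc.mono_set Ioo_subset_Icc_self)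
      (ae_restrict_of_forall_mem measurableSet_Ioo h0)]

theorem lintegral_pow_sub_rpow {s : ℝ} (q : ℕ) (h0 : 0 < s) :
    ∫⁻ x in Ioo (0 : ℝ) 1, ENNReal.ofReal (x ^ q * (1 - x ^ s)) =
      ENNReal.ofReal (1 / (q + 1) - 1 / (q + 1 + s)) := by
  have hc : Continuous fun x : ℝ => x ^ s := Real.continuous_rpow_const h0.le
  rw [setLIntegral_eq_ofReal_intervalIntegral (by fun_prop)]
  · congr 1
    have h1 : ∀ x ∈ uIcc (0 : ℝ) 1, x ^ q * (1 - x ^ s) = x ^ q - x ^ ((q : ℝ) + s) := by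
      intro x hx
      rw [uIcc_of_le zero_le_one] at hx
      rw [Real.rpow_add_of_nonneg hx.1 (by positivity) h0.le, Real.rpow_natCast]
      ring
    rw [intervalIntegral.integral_congr h1, intervalIntegral.integral_sub
      (by simp) (intervalIntegral.intervalIntegrable_rpow' (by linarith [q.cast_nonneg (α := ℝ)])),
      integral_pow, integral_rpow (Or.inl (by linarith [q.cast_nonneg (α := ℝ)]))]
    have : (q : ℝ) + s + 1 ≠ 0 := by positivity
    simp [Real.zero_rpow this]
    ring
  · intro x hx
    have := Real.rpow_le_one hx.1.le hx.2.le h0.le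
    have h2 : 0 ≤ 1 - x ^ s := by linarith
    have := hx.1
    positivity

/-- The factor 1-x clears the denominator of the inner integral. The resulting value is S_{q+1} -
S_q, which drives the telescoping. -/
theorem lintegral_pow_mul_one_sub (q : ℕ) :
    ∫⁻ x in Ioo (0 : ℝ) 1, ENNReal.ofReal (x ^ q * (1 - x)) *
      ∫⁻ t in Ioo (0 : ℝ) 1, ENNReal.ofReal (eulerWeight t / (1 - t + x * t)) =
      ENNReal.ofReal (1 / (q + 1) - Real.log ((q + 2) / (q + 1))) := by
  have h1 : ∀ x ∈ Ioo (0 : ℝ) 1, ENNReal.ofReal (x ^ q * (1 - x)) *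
      ∫⁻ t in Ioo (0 : ℝ) 1, ENNReal.ofReal (eulerWeight t / (1 - t + x * t)) =
      ∫⁻ s in Ioo (0 : ℝ) 1, ENNReal.ofReal (x ^ q * (1 - x ^ s)) := by
    intro x hx
    have h2 : 0 < 1 - x := by linarith [hx.2]
    have h3 := hx.1
    rw [lintegral_eulerWeight_div hx.1 hx.2, ← lintegral_const_mul' _ _ (by simp)]
    refine setLIntegral_congr_fun measurableSet_Ioo fun s hs => ?_
    rw [← ENNReal.ofReal_mul (by positivity)]
    congr 1
    field_simp
  rw [setLIntegral_congr_fun measurableSet_Ioo h1, lintegral_lintegral_swap (by fun_prop),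
    setLIntegral_congr_fun measurableSet_Ioo fun s hs => lintegral_pow_sub_rpow q hs.1]
  have hq : (0 : ℝ) < q + 1 := by positivity
  have hc : ContinuousOn (fun s : ℝ => 1 / ((q : ℝ) + 1 + s)) (Icc 0 1) :=
    continuousOn_const.div (by fun_prop) fun s hs => by linarith [hs.1]
  rw [setLIntegral_eq_ofReal_intervalIntegral (f := fun s : ℝ => 1 / ((q : ℝ) + 1) - 1 / (q + 1 + s))
    (continuousOn_const.sub hc)]
  · congr 1
    rw [intervalIntegral.integral_sub (by simp)
      (by rw [← uIcc_of_le zero_le_one] at hc; exact hc.intervalIntegrable)]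
    have := intervalIntegral.integral_comp_add_left (a := 0) (b := 1) (fun x : ℝ => 1 / x)
      ((q : ℝ) + 1)
    rw [this, integral_one_div_of_pos (by positivity) (by positivity)]
    simp only [intervalIntegral.integral_const, sub_zero, smul_eq_mul, one_mul, add_zero]
    congr 3
    ring
  · intro s hs
    have := hs.1
    rw [sub_nonneg]
    exact one_div_le_one_div_of_le hq (by linarith)

theorem lintegral_pow_mul_le (q : ℕ) :
    ∫⁻ x in Ioo (0 : ℝ) 1, ENNReal.ofReal (x ^ q) *
      ∫⁻ t in Ioo (0 : ℝ) 1, ENNReal.ofReal (eulerWeight t / (1 - t + x * t)) ≤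
      ENNReal.ofReal (1 / (q + 1)) := by
  have h : ∫⁻ x in Ioo (0 : ℝ) 1, ENNReal.ofReal (x ^ q) = ENNReal.ofReal (1 / (q + 1)) := by
    rw [setLIntegral_eq_ofReal_intervalIntegral (by fun_prop)
      fun x hx => pow_nonneg hx.1.le q]
    simp
  rw [← h]
  refine setLIntegral_mono (by fun_prop) fun x hx => ?_
  calc _ ≤ ENNReal.ofReal (x ^ q) * 1 := by
        gcongr
        exact lintegral_eulerWeight_div_le_one hx.1 hx.2
    _ = _ := mul_one _

theorem lintegral_pow_mul_succ (q : ℕ) :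
    ∫⁻ x in Ioo (0 : ℝ) 1, ENNReal.ofReal (x ^ q) *
      ∫⁻ t in Ioo (0 : ℝ) 1, ENNReal.ofReal (eulerWeight t / (1 - t + x * t)) =
    (∫⁻ x in Ioo (0 : ℝ) 1, ENNReal.ofReal (x ^ (q + 1)) *
      ∫⁻ t in Ioo (0 : ℝ) 1, ENNReal.ofReal (eulerWeight t / (1 - t + x * t))) +
      ENNReal.ofReal (1 / (q + 1) - Real.log ((q + 2) / (q + 1))) := by
  rw [← lintegral_pow_mul_one_sub, ← lintegral_add_right _ (by fun_prop)]
  refine setLIntegral_congr_fun measurableSet_Ioo fun x hx => ?_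
  have h2 : 0 < 1 - x := by linarith [hx.2]
  have h3 := hx.1
  rw [← add_mul, ← ENNReal.ofReal_add (by positivity) (by positivity)]
  congr 2
  ring

/-- With J_q the left side, J_q + S_q does not depend on q, and J_q ≤ 1/(q+1) tends to 0; the
constant is therefore the limit of S_q, which is γ. -/
theorem lintegral_pow_mul_eq (q : ℕ) :
    ∫⁻ x in Ioo (0 : ℝ) 1, ENNReal.ofReal (x ^ q) *
      ∫⁻ t in Ioo (0 : ℝ) 1, ENNReal.ofReal (eulerWeight t / (1 - t + x * t)) =
      ENNReal.ofReal (Real.eulerMascheroniConstant - Real.eulerMascheroniSeq q) := by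
  set J : ℕ → ENNReal := fun q => ∫⁻ x in Ioo (0 : ℝ) 1, ENNReal.ofReal (x ^ q) *
      ∫⁻ t in Ioo (0 : ℝ) 1, ENNReal.ofReal (eulerWeight t / (1 - t + x * t)) with hJ
  have hle : ∀ q, J q ≤ ENNReal.ofReal (1 / (q + 1)) := lintegral_pow_mul_le
  have hfin : ∀ q, J q ≠ ⊤ := fun q => ne_top_of_le_ne_top ENNReal.ofReal_ne_top (hle q)
  have hstep : ∀ q : ℕ, (J q).toReal + Real.eulerMascheroniSeq q =
      (J (q + 1)).toReal + Real.eulerMascheroniSeq (q + 1) := by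
    intro q
    have hq : (0 : ℝ) < q + 1 := by positivity
    have h1 : J q = J (q + 1) + _ := lintegral_pow_mul_succ q
    have h2 : 0 ≤ 1 / ((q : ℝ) + 1) - Real.log ((q + 2) / (q + 1)) := by
      have := Real.log_le_sub_one_of_pos (x := ((q : ℝ) + 2) / (q + 1)) (by positivity)
      have e : ((q : ℝ) + 2) / (q + 1) - 1 = 1 / (q + 1) := by field_simp; ring
      linarith
    rw [h1, ENNReal.toReal_add (hfin _) ENNReal.ofReal_ne_top, ENNReal.toReal_ofReal h2]
    unfold Real.eulerMascheroniSeq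
    rw [harmonic_succ, Real.log_div (by positivity) (by positivity)]
    push_cast
    rw [show (q : ℝ) + 1 + 1 = q + 2 by ring]
    ring
  have hconst : ∀ k, (J (q + k)).toReal + Real.eulerMascheroniSeq (q + k) =
      (J q).toReal + Real.eulerMascheroniSeq q := by
    intro k
    induction k with
    | zero => rfl
    | succ k ih => rw [← ih, hstep (q + k)]; rfl
  have hlim0 : Filter.Tendsto (fun k => (J k).toReal) Filter.atTop (nhds 0) := by
    refine squeeze_zero (fun _ => ENNReal.toReal_nonneg) (fun k => ?_)
      tendsto_one_div_add_atTop_nhds_zero_nat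
    exact ENNReal.toReal_le_of_le_ofReal (by positivity) (hle k)
  have hlim := hlim0.add Real.tendsto_eulerMascheroniSeq
  rw [zero_add] at hlim
  have hlim' := hlim.comp (Filter.tendsto_add_atTop_nat q)
  have heq : (J q).toReal + Real.eulerMascheroniSeq q = Real.eulerMascheroniConstant := by
    refine tendsto_nhds_unique (tendsto_const_nhds.congr fun k => ?_) hlim'
    simp only [Function.comp]
    rw [add_comm k q, hconst]
  change J q = _
  rw [← ENNReal.ofReal_toReal (hfin q)]
  congr 1
  linarith

theorem lintegral_prod_pow_mul_eulerWeight_div (q : ℕ) :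
    ∫⁻ p in Ioo (0 : ℝ) 1 ×ˢ Ioo (0 : ℝ) 1,
      ENNReal.ofReal (p.1 ^ q * (eulerWeight p.2 / (1 - p.2 + p.1 * p.2))) =
      ENNReal.ofReal (Real.eulerMascheroniConstant - Real.eulerMascheroniSeq q) := by
  rw [Measure.volume_eq_prod, ← Measure.prod_restrict, lintegral_prod _ (by fun_prop),
    ← lintegral_pow_mul_eq]
  refine setLIntegral_congr_fun measurableSet_Ioo fun x hx => ?_
  simp only
  rw [← lintegral_const_mul' _ _ (by simp)]
  refine lintegral_congr fun t => ?_
  rw [← ENNReal.ofReal_mul (pow_nonneg hx.1.le q)]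

theorem pow_mul_eulerWeight_div_nonneg (q : ℕ) {p : ℝ × ℝ}
    (hp : p ∈ Ioo (0 : ℝ) 1 ×ˢ Ioo (0 : ℝ) 1) :
    0 ≤ p.1 ^ q * (eulerWeight p.2 / (1 - p.2 + p.1 * p.2)) := by
  obtain ⟨⟨h1, h2⟩, h3, h4⟩ := hp
  have := eulerWeight_nonneg h3.le
  have : 0 < 1 - p.2 := by linarith
  positivity

theorem integrableOn_pow_mul_eulerWeight_div (q : ℕ) :
    IntegrableOn (fun p : ℝ × ℝ => p.1 ^ q * (eulerWeight p.2 / (1 - p.2 + p.1 * p.2)))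
      (Ioo (0 : ℝ) 1 ×ˢ Ioo (0 : ℝ) 1) := by
  refine (lintegral_ofReal_ne_top_iff_integrable (Measurable.aestronglyMeasurable (by fun_prop))
    (ae_restrict_of_forall_mem (measurableSet_Ioo.prod measurableSet_Ioo)
      fun p hp => pow_mul_eulerWeight_div_nonneg q hp)).1 ?_
  rw [lintegral_prod_pow_mul_eulerWeight_div]
  exact ENNReal.ofReal_ne_top

/-- The double integral representation of the error in the limit defining Euler's constant. -/
theorem integral_pow_mul_eulerWeight_div (q : ℕ) :
    ∫ p in Ioo (0 : ℝ) 1 ×ˢ Ioo (0 : ℝ) 1,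
      p.1 ^ q * (eulerWeight p.2 / (1 - p.2 + p.1 * p.2)) =
      Real.eulerMascheroniConstant - Real.eulerMascheroniSeq q := by
  rw [integral_eq_lintegral_of_nonneg_ae
    (ae_restrict_of_forall_mem (measurableSet_Ioo.prod measurableSet_Ioo)
      fun p hp => pow_mul_eulerWeight_div_nonneg q hp)
    (Measurable.aestronglyMeasurable (by fun_prop)),
    lintegral_prod_pow_mul_eulerWeight_div, ENNReal.toReal_ofReal]
  have := Real.eulerMascheroniSeq_lt_eulerMascheroniConstant q
  linarith

end

/-! ### The chain of partial integrations and its bound. -/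

section
open Finset

theorem principalNorm_X_sub_one_pow (A M : ℕ) : principalNorm ((X - 1) ^ A) 1 M = M.factorial := by
  simp [principalNorm, coeff_zero_eq_eval_zero]

/-- Only powers z^(-n-1) and lower occur, and for z ≥ 1 each is at most z^(-n-1). -/
theorem abs_laurent_le {R : ℝ[X]} {K n : ℕ} (h : ∀ i, K ≤ i → R.coeff i = 0) {z : ℝ} (hz : 1 ≤ z) :
    |R.eval z / z ^ (K + n)| ≤ principalNorm R K 0 / z ^ (n + 1) := by
  have hz0 : 0 < z := by linarith
  have hK : K = 0 → R = 0 := fun hK => Polynomial.ext fun i => by simpa using h i (by omega)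
  rw [abs_div, abs_of_nonneg (by positivity : 0 ≤ z ^ (K + n)),
    div_le_div_iff₀ (by positivity) (by positivity)]
  -- At `K = 0` the exponent `K - 1` used below would be truncated; there R = 0.
  rcases Nat.eq_zero_or_pos K with h0 | h0
  · simp [hK h0, h0, principalNorm]
  have hdeg : R.natDegree < K := by
    have : R.natDegree ≤ K - 1 := natDegree_le_iff_coeff_eq_zero.2 fun i hi => h i (by omega)
    omega
  have hev : |R.eval z| ≤ principalNorm R K 0 * z ^ (K - 1) := by
    rw [eval_eq_sum_range' hdeg, principalNorm, sum_mul]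
    refine (abs_sum_le_sum_abs _ _).trans (sum_le_sum fun i hi => ?_)
    rw [abs_mul, abs_of_nonneg (by positivity : 0 ≤ z ^ i)]
    simp only [Nat.ascFactorial_zero, Nat.cast_one, mul_one]
    have := mem_range.1 hi
    gcongr
    omega
  calc _ ≤ principalNorm R K 0 * z ^ (K - 1) * z ^ (n + 1) := by gcongr
    _ = _ := by
      rw [mul_assoc, ← pow_add]
      congr 2
      omega

/-- Iterated partial integration along a chain of polynomials with `D ^ n_{j+1} U_{j+1} = X U_j`:
the derivatives are moved to the Laurent polynomial `(z - 1) ^ A / z` in `z = 1 + c x`. -/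
theorem exists_laurent_chain {m : ℕ} {n : ℕ → ℕ} {U : ℕ → ℝ[X]} {A : ℕ} {c : ℝ} (hc : 0 ≤ c)
    (h0 : ∀ j ∈ Icc 1 m, X ^ n j ∣ U j) (h1 : ∀ j ∈ Icc 1 m, (X - 1) ^ n j ∣ U j)
    (hU : ∀ j ∈ Icc 1 m, j + 1 ≤ m → derivative^[n (j + 1)] (U (j + 1)) = X * U j)
    (j : ℕ) (hj : j + 1 ≤ m) (hA : (∑ i ∈ Icc 1 j, n i) + j ≤ A) :
    ∃ (S : ℝ[X]) (K : ℕ), (X - 1) ^ (A - ((∑ i ∈ Icc 1 j, n i) + j)) ∣ S ∧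
      (∀ i, K + (A - ((∑ i ∈ Icc 1 j, n i) + j)) ≤ i → S.coeff i = 0) ∧
      (∀ M, principalNorm S K M ≤ ((M + (∑ i ∈ Icc 1 j, n i) + j).factorial : ℝ) /
        ∏ i ∈ Icc 1 j, ((M : ℝ) + ∑ l ∈ Icc (i + 1) j, (n l : ℝ) + (j - i) + 1)) ∧
      |∫ x in (0 : ℝ)..1, (derivative^[n 1] (U 1)).eval x * ((c * x) ^ A / (1 + c * x))| =
        c ^ ((∑ i ∈ Icc 1 j, n i) + j) * |∫ x in (0 : ℝ)..1,
          (derivative^[n (j + 1)] (U (j + 1))).eval x * (S.eval (1 + c * x) / (1 + c * x) ^ K)| := by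
  induction j with
  | zero =>
    refine ⟨(X - 1) ^ A, 1, by simp, fun i hi => ?_, fun M => ?_, ?_⟩
    · refine coeff_eq_zero_of_natDegree_lt ?_
      rw [← C_1, natDegree_pow, natDegree_X_sub_C]
      simp at hi
      omega
    · simp [principalNorm_X_sub_one_pow]
    · simp
  | succ j ih =>
    rw [sum_Icc_succ_top (by omega)] at hA
    obtain ⟨R, K, hR1, hR2, hR3, hR4⟩ := ih (by omega) (by omega)
    have hmem : j + 1 ∈ Icc 1 m := by simp; omega
    set a := ∑ i ∈ Icc 1 j, n i with ha
    -- The bound `hA` leaves at least one zero at z = 1 after n_{j+1} derivatives, so a factor z - 1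
    -- can be split off.
    have hd : (X - 1) ∣ laurentDerivIter K R (n (j + 1)) := by
      refine (dvd_pow_self _ ?_).trans (pow_dvd_laurentDerivIter hR1 (n (j + 1)))
      omega
    have hd' := pow_dvd_laurentDerivIter (K := K) hR1 (n (j + 1))
    obtain ⟨S, hS⟩ := hd
    have hne : (X - 1 : ℝ[X]) ≠ 0 := by rw [← C_1]; exact X_sub_C_ne_zero 1
    have hexp : A - (a + j) - n (j + 1) = A - (a + n (j + 1) + (j + 1)) + 1 := by omega
    have hS2 : ∀ i, K + n (j + 1) + (A - (a + n (j + 1) + (j + 1))) ≤ i → S.coeff i = 0 := by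
      have hz := coeff_laurentDerivIter_eq_zero (n := n (j + 1)) hR2
      rw [hexp, hS] at hz
      have hdeg : ((X - 1) * S).degree <
          ((K + n (j + 1) + (A - (a + n (j + 1) + (j + 1))) + 1 : ℕ) : WithBot ℕ) :=
        (degree_lt_iff_coeff_zero _ _).2 hz
      refine (degree_lt_iff_coeff_zero _ _).1 ?_
      rw [degree_mul, ← C_1, degree_X_sub_C] at hdeg
      rcases eq_or_ne S 0 with h | h
      · rw [h, degree_zero]; exact WithBot.bot_lt_coe _
      · rw [degree_eq_natDegree h] at hdeg ⊢
        norm_cast at hdeg ⊢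
        omega
    refine ⟨S, K + n (j + 1), ?_, ?_, ?_, ?_⟩
    · rw [hexp, hS, pow_succ, mul_comm _ (X - 1)] at hd'
      rw [sum_Icc_succ_top (by omega)]
      exact (mul_dvd_mul_iff_left hne).1 hd'
    · rw [sum_Icc_succ_top (by omega)]
      exact hS2
    · intro M
      refine (principalNorm_le_of_eq_X_sub_one_mul hS _ M).trans ?_
      rw [principalNorm_laurentDerivIter, prod_Icc_succ_top (by omega)]
      -- The weight order rises by n_{j+1} for the derivatives and by 1 for the division by z - 1.
      have hb := hR3 (M + 1 + n (j + 1))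
      rw [div_le_iff₀ (by positivity)]
      refine hb.trans (le_of_eq ?_)
      have e1 : M + 1 + n (j + 1) + a + j = M + ∑ i ∈ Icc 1 (j + 1), n i + (j + 1) := by
        rw [sum_Icc_succ_top (by omega)]
        omega
      have e2 : ∏ i ∈ Icc 1 j, (((M + 1 + n (j + 1) : ℕ) : ℝ) +
          ∑ l ∈ Icc (i + 1) j, (n l : ℝ) + (j - i) + 1) = ∏ i ∈ Icc 1 j, ((M : ℝ) +
          ∑ l ∈ Icc (i + 1) (j + 1), (n l : ℝ) + (((j + 1 : ℕ) : ℝ) - i) + 1) := by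
        refine prod_congr rfl fun i hi => ?_
        have := (mem_Icc.1 hi).2
        rw [sum_Icc_succ_top (by omega)]
        push_cast
        ring
      rw [e1, e2]
      have e3 : (M : ℝ) + ∑ l ∈ Icc (j + 1 + 1) (j + 1), (n l : ℝ) +
          (((j + 1 : ℕ) : ℝ) - ((j + 1 : ℕ) : ℝ)) + 1 = M + 1 := by
        simp
      rw [e3]
      have : (M : ℝ) + 1 ≠ 0 := by positivity
      rw [div_mul_eq_div_div, div_mul_cancel₀ _ this]
    · rw [hR4, integral_iterate_derivative_mul_laurent _ _ _ _ hc (h0 _ hmem) (h1 _ hmem), hS,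
        hU _ hmem hj, sum_Icc_succ_top (by omega)]
      -- The split factor z - 1 equals cx: the x turns U_{j+1} into the next iterated derivative,
      -- the c joins the power in front.
      have e : ∀ x : ℝ, eval x (U (j + 1)) * (eval (1 + c * x) ((X - 1) * S) /
          (1 + c * x) ^ (K + n (j + 1))) = c * (eval x (X * U (j + 1)) *
            (eval (1 + c * x) S / (1 + c * x) ^ (K + n (j + 1)))) := by
        intro x
        simp only [eval_mul, eval_sub, eval_X, eval_one, add_sub_cancel_left]
        ring
      simp only [e, intervalIntegral.integral_const_mul]
      rw [abs_mul, abs_mul, abs_pow, abs_neg, abs_of_nonneg hc]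
      ring

theorem abs_integral_chain_le {m : ℕ} (hm : 1 ≤ m) {n : ℕ → ℕ} {U : ℕ → ℝ[X]} {A : ℕ} {c : ℝ}
    (hc : 0 ≤ c)
    (h0 : ∀ j ∈ Icc 1 m, X ^ n j ∣ U j) (h1 : ∀ j ∈ Icc 1 m, (X - 1) ^ n j ∣ U j)
    (hU : ∀ j ∈ Icc 1 m, j + 1 ≤ m → derivative^[n (j + 1)] (U (j + 1)) = X * U j)
    (hpos : ∀ x ∈ Set.Icc (0 : ℝ) 1, 0 ≤ (U m).eval x)
    (hlow : (∑ i ∈ Icc 1 (m - 1), n i) + (m - 1) ≤ A)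
    (hupp : A ≤ (∑ i ∈ Icc 1 m, n i) + (m - 1)) :
    |∫ x in (0 : ℝ)..1, (derivative^[n 1] (U 1)).eval x * ((c * x) ^ A / (1 + c * x))| ≤
      c ^ ((∑ i ∈ Icc 1 m, n i) + (m - 1)) *
        ((((∑ i ∈ Icc 1 m, n i) + (m - 1)).factorial : ℝ) /
          ∏ i ∈ Icc 1 (m - 1), ((∑ l ∈ Icc (i + 1) m, (n l : ℝ)) + (m - i))) *
        ∫ x in (0 : ℝ)..1, (U m).eval x / (1 + c * x) ^ (n m + 1) := by
  obtain ⟨j, rfl⟩ : ∃ j, m = j + 1 := ⟨m - 1, by omega⟩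
  simp only [Nat.add_sub_cancel] at *
  obtain ⟨S, K, -, hS2, hS3, hS4⟩ := exists_laurent_chain (A := A) hc h0 h1 hU j le_rfl hlow
  have hmem : j + 1 ∈ Icc 1 (j + 1) := by simp
  rw [hS4, integral_iterate_derivative_mul_laurent _ _ _ _ hc (h0 _ hmem) (h1 _ hmem)]
  rw [sum_Icc_succ_top (by omega)] at hupp ⊢
  -- This is where `hupp` enters: the remaining polynomial part has degree below n_m and does not
  -- survive the last n_m derivatives.
  have hcoef := coeff_laurentDerivIter_eq_zero_of_le (n := n (j + 1)) (by omega) hS2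
  set T := laurentDerivIter K S (n (j + 1)) with hT
  set B : ℝ := (((∑ i ∈ Icc 1 j, n i) + n (j + 1) + j).factorial : ℝ) /
          ∏ i ∈ Icc 1 j, ((∑ l ∈ Icc (i + 1) (j + 1), (n l : ℝ)) + (((j + 1 : ℕ) : ℝ) - i)) with hB
  have hTB : principalNorm T K 0 ≤ B := by
    -- At order 0 all weights are 1, and T has no coefficient from index K on, so the cutoffs K and
    -- K + n_m give the same norm.
    have e1 : principalNorm T K 0 = principalNorm T (K + n (j + 1)) 0 := by
      simp only [principalNorm, Nat.ascFactorial_zero]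
      rw [sum_range_add, left_eq_add]
      exact sum_eq_zero fun i _ => by rw [hcoef _ (by omega)]; simp
    rw [e1, hT, principalNorm_laurentDerivIter, zero_add]
    refine (hS3 _).trans (le_of_eq ?_)
    rw [hB, add_comm (n (j + 1))]
    congr 1
    refine prod_congr rfl fun i hi => ?_
    have := (mem_Icc.1 hi).2
    rw [sum_Icc_succ_top (by omega)]
    push_cast
    ring
  have hbound : |∫ x in (0 : ℝ)..1, (U (j + 1)).eval x *
      (T.eval (1 + c * x) / (1 + c * x) ^ (K + n (j + 1)))| ≤
      B * ∫ x in (0 : ℝ)..1, (U (j + 1)).eval x / (1 + c * x) ^ (n (j + 1) + 1) := by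
    rw [← intervalIntegral.integral_const_mul, ← Real.norm_eq_abs]
    refine intervalIntegral.norm_integral_le_of_norm_le zero_le_one ?_ ?_
    · refine Filter.Eventually.of_forall fun x hx => ?_
      have hx' : x ∈ Set.Icc (0 : ℝ) 1 := Set.Ioc_subset_Icc_self hx
      have hz : 1 ≤ 1 + c * x := by have := mul_nonneg hc hx'.1; linarith
      have hz0 : 0 < 1 + c * x := by linarith
      rw [Real.norm_eq_abs, abs_mul, abs_of_nonneg (hpos x hx')]
      calc _ ≤ (U (j + 1)).eval x * (B / (1 + c * x) ^ (n (j + 1) + 1)) := by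
            refine mul_le_mul_of_nonneg_left ((abs_laurent_le hcoef hz).trans ?_) (hpos x hx')
            gcongr
        _ = _ := by ring
    · refine ContinuousOn.intervalIntegrable ?_
      refine continuousOn_const.mul ?_
      have := (U (j + 1)).continuous.continuousOn.mul (continuousOn_laurent 1 (n (j + 1) + 1) hc)
      refine this.congr fun x _ => ?_
      simp [div_eq_mul_inv]
  rw [abs_mul, abs_pow, abs_neg, abs_of_nonneg hc]
  calc _ = c ^ ((∑ i ∈ Icc 1 j, n i) + n (j + 1) + j) * |∫ x in (0 : ℝ)..1, (U (j + 1)).eval x *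
      (T.eval (1 + c * x) / (1 + c * x) ^ (K + n (j + 1)))| := by ring
    _ ≤ _ := by
      rw [mul_assoc]
      exact mul_le_mul_of_nonneg_left hbound (by positivity)

/-! ### The polynomials U_j and their coefficients. -/

/-- The polynomials `∑_k (-1)^k (N choose k) ∏_{j < i ≤ m} (r k + e_i)^{\underline{n_i}} X^{r k + e_j}`,
which arise from `X ^ e_m (1 - X ^ r) ^ N` by alternately taking iterated derivatives and dividing
by `X`. -/
noncomputable def chainPoly (N r m : ℕ) (n e : ℕ → ℕ) (j : ℕ) : ℝ[X] :=
  ∑ k ∈ range (N + 1), C ((-1) ^ k * (N.choose k : ℝ) *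
    ∏ i ∈ Ioc j m, ((r * k + e i).descFactorial (n i) : ℝ)) * X ^ (r * k + e j)

theorem iterate_derivative_chainPoly (N r : ℕ) {m j a : ℕ} {n e : ℕ → ℕ} (hj : j + 1 ≤ m)
    (he : e (j + 1) = a + n (j + 1)) :
    derivative^[n (j + 1)] (chainPoly N r m n e (j + 1)) =
      ∑ k ∈ range (N + 1), C ((-1) ^ k * (N.choose k : ℝ) *
        ∏ i ∈ Ioc j m, ((r * k + e i).descFactorial (n i) : ℝ)) * X ^ (r * k + a) := by
  rw [chainPoly, iterate_derivative_sum]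
  refine sum_congr rfl fun k _ => ?_
  have hIoc : Ioc j m = insert (j + 1) (Ioc (j + 1) m) := by
    ext i; simp only [mem_Ioc, mem_insert]; omega
  rw [iterate_derivative_C_mul, iterate_derivative_X_pow_eq_C_mul, hIoc, prod_insert (by simp),
    ← mul_assoc, ← C_mul]
  congr 2
  · ring_nf
  · omega

theorem chainPoly_self (N r m : ℕ) (n e : ℕ → ℕ) :
    chainPoly N r m n e m = X ^ e m * (1 - X ^ r) ^ N := by
  have : (1 - X ^ r : ℝ[X]) = -X ^ r + 1 := by ring
  rw [chainPoly, this, add_pow, mul_sum]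
  refine sum_congr rfl fun k _ => ?_
  simp only [Ioc_self, prod_empty, mul_one, one_pow, C_mul, C_pow, C_neg, C_1, map_natCast]
  rw [neg_pow, pow_add, pow_mul]
  ring

theorem X_pow_dvd_chainPoly (N r m : ℕ) {n e : ℕ → ℕ} {j : ℕ} (h : n j ≤ e j) :
    X ^ n j ∣ chainPoly N r m n e j :=
  dvd_sum fun _ _ => (pow_dvd_pow X (by omega)).mul_left _

/-- Descend from U_m, where (1-X^r)^N supplies N zeros at 1. Each block of n_{j+1} derivatives loses
that many, and the division by X loses none because X and X-1 are coprime. -/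
theorem X_sub_one_pow_dvd_chainPoly {N m : ℕ} (r : ℕ) {n e : ℕ → ℕ} (hN : N = ∑ i ∈ Icc 1 m, n i)
    (he : ∀ j ∈ Icc 1 m, e (j + 1) = e j + 1 + n (j + 1)) {j : ℕ} (hj : 1 ≤ j) (hjm : j ≤ m) :
    (X - 1) ^ (∑ i ∈ Icc 1 j, n i) ∣ chainPoly N r m n e j := by
  obtain ⟨d, hd⟩ : ∃ d, j + d = m := ⟨m - j, by omega⟩
  induction d generalizing j with
  | zero =>
    obtain rfl : j = m := by omega
    rw [chainPoly_self, ← hN]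
    refine (pow_dvd_pow_of_dvd ?_ N).mul_left _
    rw [← dvd_neg, neg_sub]
    simpa using sub_dvd_pow_sub_pow (X : ℝ[X]) 1 r
  | succ d ih =>
    have h := pow_sub_dvd_iterate_derivative_of_pow_dvd (n (j + 1))
      (ih (j := j + 1) (by omega) (by omega) (by omega))
    rw [sum_Icc_succ_top (by omega), Nat.add_sub_cancel, iterate_derivative_chainPoly N r (by omega)
      (he j (by simp; omega))] at h
    have e1 : ∀ k, (X : ℝ[X]) ^ (r * k + (e j + 1)) = X ^ (r * k + e j) * X := fun k => by
      rw [← add_assoc, pow_succ]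
    simp only [e1, ← mul_assoc] at h
    rw [← sum_mul] at h
    have hcop : IsCoprime (X - 1 : ℝ[X]) X := ⟨-1, 1, by ring⟩
    exact hcop.pow_left.dvd_of_dvd_mul_right h

/-- In k the product is a polynomial of degree N with leading coefficient r^N, so its N-th finite
difference is N! r^N. -/
theorem sum_alternating_prod_descFactorial {N m : ℕ} (r : ℕ) (hr : 1 ≤ r) {n : ℕ → ℕ} (e : ℕ → ℕ)
    (hN : N = ∑ i ∈ Icc 1 m, n i) :
    ∑ k ∈ range (N + 1), (-1 : ℝ) ^ k * (N.choose k : ℝ) *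
      ∏ i ∈ Icc 1 m, ((r * k + e i).descFactorial (n i) : ℝ) = N.factorial * (-(r : ℝ)) ^ N := by
  have hr0 : (r : ℝ) ≠ 0 := by positivity
  set P : ℝ[X] := ∏ i ∈ Icc 1 m, (descPochhammer ℝ (n i)).comp (C (r : ℝ) * X + C (e i : ℝ)) with hP
  have hlin : ∀ i, (C (r : ℝ) * X + C (e i : ℝ)).natDegree = 1 := fun i => natDegree_linear hr0
  have hne : ∀ i, (descPochhammer ℝ (n i)).comp (C (r : ℝ) * X + C (e i : ℝ)) ≠ 0 := by
    intro i h
    have := leadingCoeff_comp (p := descPochhammer ℝ (n i)) (q := C (r : ℝ) * X + C (e i : ℝ))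
      (by rw [hlin]; simp)
    rw [h, leadingCoeff_zero, (monic_descPochhammer ℝ (n i)).leadingCoeff,
      leadingCoeff_linear hr0, one_mul] at this
    exact pow_ne_zero _ hr0 this.symm
  have hdeg : P.natDegree = N := by
    rw [hP, natDegree_prod _ _ fun i _ => hne i, hN]
    refine sum_congr rfl fun i _ => ?_
    rw [natDegree_comp, hlin, mul_one, descPochhammer_natDegree]
  have hlead : P.leadingCoeff = (r : ℝ) ^ N := by
    rw [hP, leadingCoeff_prod, hN, ← prod_pow_eq_pow_sum]
    refine prod_congr rfl fun i _ => ?_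
    rw [leadingCoeff_comp (by rw [hlin]; simp), (monic_descPochhammer ℝ (n i)).leadingCoeff,
      leadingCoeff_linear hr0, one_mul, descPochhammer_natDegree]
  have heval : ∀ k : ℕ, P.eval (k : ℝ) =
      ∏ i ∈ Icc 1 m, ((r * k + e i).descFactorial (n i) : ℝ) := by
    intro k
    rw [hP, eval_prod]
    refine prod_congr rfl fun i _ => ?_
    rw [eval_comp, ← descPochhammer_eval_eq_descFactorial]
    simp
  have key := congrFun P.fwdDiff_iter_degree_eq_factorial 0
  rw [hdeg, hlead, fwdDiff_iter_eq_sum_shift] at key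
  simp only [nsmul_eq_mul, mul_one, zero_add, heval, zsmul_eq_mul] at key
  have h2 := congrArg ((-1 : ℝ) ^ N * ·) key
  simp only [mul_sum] at h2
  calc _ = _ := sum_congr rfl fun k hk => ?_
    _ = _ := h2
    _ = _ := ?_
  · obtain ⟨d, rfl⟩ := Nat.exists_eq_add_of_le (Nat.lt_succ_iff.1 (mem_range.1 hk))
    push_cast
    rw [Nat.add_sub_cancel_left, pow_add]
    have : (-1 : ℝ) ^ d * (-1) ^ d = 1 := by rw [← mul_pow]; simp
    linear_combination (-(-1 : ℝ) ^ k * ((k + d).choose k : ℝ) *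
      ∏ i ∈ Icc 1 m, ((r * k + e i).descFactorial (n i) : ℝ)) * this
  · simp only [Pi.smul_apply, Pi.natCast_apply, smul_eq_mul]
    rw [neg_pow (r : ℝ)]
    ring

theorem abs_integral_derivative_chain_le {m r τ₀ τ₁ N d : ℕ} (hm : 1 ≤ m) (hr : 1 ≤ r)
    {n : ℕ → ℕ} (hN : N = ∑ j ∈ Icc 1 m, n j) (hd : d ≤ n m)
    (hτ : τ₀ + d = N + τ₁ + (m - 1)) {U : ℕ → ℝ[X]}
    (h0 : ∀ j ∈ Icc 1 m, X ^ n j ∣ U j) (h1 : ∀ j ∈ Icc 1 m, (X - 1) ^ n j ∣ U j)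
    (hU : ∀ j ∈ Icc 1 m, j + 1 ≤ m → derivative^[n (j + 1)] (U (j + 1)) = X * U j)
    (hUm : U m = X ^ (N + τ₁ + (m - 1)) * (1 - X ^ r) ^ N)
    {t : ℝ} (ht0 : 0 < t) (ht1 : t < 1) :
    |∫ x in (0 : ℝ)..1, (derivative^[n 1] (U 1)).eval x * x ^ (N + (m - 1) - d) *
        (eulerWeight t / (1 - t + x * t))| ≤
      (r : ℝ) ^ N * (((N + (m - 1)).factorial : ℝ) /
          ∏ i ∈ Icc 1 (m - 1), ((∑ l ∈ Icc (i + 1) m, (n l : ℝ)) + (m - i))) *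
        ∫ x in (0 : ℝ)..1, eulerIntegrand N (n m) m r τ₀ τ₁ x t := by
  have ht : 0 < 1 - t := by linarith
  have hsum : ∑ i ∈ Icc 1 m, n i = (∑ i ∈ Icc 1 (m - 1), n i) + n m := by
    obtain ⟨j, rfl⟩ : ∃ j, m = j + 1 := ⟨m - 1, by omega⟩
    rw [sum_Icc_succ_top (by omega), Nat.add_sub_cancel]
  -- Chosen so that 1-t+xt = (1-t)(1+cx).
  set c := t / (1 - t) with hc
  have hc0 : 0 < c := div_pos ht0 ht
  set A := N + (m - 1) - d with hA
  have hω := eulerWeight_nonneg ht0.le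
  have hpos : ∀ x ∈ Set.Icc (0 : ℝ) 1, 0 ≤ (U m).eval x := by
    intro x hx
    rw [hUm]
    have : 0 ≤ 1 - x ^ r := by have := pow_le_one₀ (n := r) hx.1 hx.2; linarith
    simp only [eval_mul, eval_pow, eval_X, eval_sub, eval_one]
    have := hx.1
    positivity
  have key := abs_integral_chain_le hm hc0.le h0 h1 hU hpos (A := A) (by omega) (by omega)
  rw [← hN] at key
  set B : ℝ := ((N + (m - 1)).factorial : ℝ) /
          ∏ i ∈ Icc 1 (m - 1), ((∑ l ∈ Icc (i + 1) m, (n l : ℝ)) + (m - i)) with hB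
  have hs : ∀ x, 1 + c * x = (1 - t + x * t) / (1 - t) := by
    intro x; rw [hc]; field_simp
  have hL : ∀ x : ℝ, (derivative^[n 1] (U 1)).eval x * x ^ A * (eulerWeight t / (1 - t + x * t)) =
      (eulerWeight t / (c ^ A * (1 - t))) *
        ((derivative^[n 1] (U 1)).eval x * ((c * x) ^ A / (1 + c * x))) := by
    intro x
    rw [hs, mul_pow]
    field_simp
  -- The power of c left over is c^d: it yields t^d, and its denominator (1-t)^d lowers the exponent
  -- of 1-t from n_m to n_m - d.
  have hR : ∀ x : ℝ, (eulerWeight t / (c ^ A * (1 - t))) * c ^ (N + (m - 1)) *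
      ((U m).eval x / (1 + c * x) ^ (n m + 1)) =
      (r : ℝ) ^ N * eulerIntegrand N (n m) m r τ₀ τ₁ x t := by
    intro x
    have e1 : N + (m - 1) = A + d := by omega
    have e2 : N + τ₁ + m - 1 - τ₀ = d := by omega
    have e3 : τ₀ + n m + 1 - (N + τ₁ + m) = n m - d := by omega
    have e4 : N + τ₁ + m - 1 = N + τ₁ + (m - 1) := by omega
    have e5 : (1 - t) ^ (n m + 1) = (1 - t) * ((1 - t) ^ d * (1 - t) ^ (n m - d)) := by
      rw [← pow_add, ← pow_succ']
      congr 1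
      omega
    unfold eulerIntegrand
    have e6 : c ^ d = t ^ d / (1 - t) ^ d := by rw [hc, div_pow]
    rw [e2, e3, e4, hs, hUm, e1, div_pow (1 - t + x * t) (1 - t), e5, pow_add c, e6]
    simp only [eval_mul, eval_pow, eval_X, eval_sub, eval_one]
    have hr0 : (r : ℝ) ≠ 0 := by positivity
    field_simp
  simp only [hL, intervalIntegral.integral_const_mul]
  rw [abs_mul, abs_of_nonneg (by positivity)]
  calc _ ≤ eulerWeight t / (c ^ A * (1 - t)) * (c ^ (N + (m - 1)) * B *
        ∫ x in (0 : ℝ)..1, (U m).eval x / (1 + c * x) ^ (n m + 1)) :=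
        mul_le_mul_of_nonneg_left key (by positivity)
    _ = B * ∫ x in (0 : ℝ)..1, (eulerWeight t / (c ^ A * (1 - t))) * c ^ (N + (m - 1)) *
        ((U m).eval x / (1 + c * x) ^ (n m + 1)) := by
      rw [intervalIntegral.integral_const_mul]
      ring
    _ = _ := by
      simp only [hR, intervalIntegral.integral_const_mul]
      ring

theorem factorial_mul_prod_Icc_add (N k : ℕ) :
    (N.factorial : ℝ) * ∏ j ∈ Icc 1 k, ((N : ℝ) + j) = ((N + k).factorial : ℝ) := by
  induction k with
  | zero => simp
  | succ k ih =>
    rw [prod_Icc_succ_top (by omega), ← mul_assoc, ih, ← add_assoc, Nat.factorial_succ]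
    push_cast
    ring

end

/-! ### Integrability and the final estimate. -/

section
open MeasureTheory Set

@[fun_prop]
theorem measurable_eulerIntegrand (N l m r τ₀ τ₁ : ℕ) :
    Measurable fun p : ℝ × ℝ => eulerIntegrand N l m r τ₀ τ₁ p.1 p.2 := by
  unfold eulerIntegrand
  fun_prop

/-- The integrand is dominated by ω(t)/(1-t+xt), the case q = 0 of the representation: x ≤ 1-t+xt
lets the power of x absorb the extra denominators. -/
theorem integrableOn_eulerIntegrand {N l m r : ℕ} (τ₀ τ₁ : ℕ) (hm : 1 ≤ m) (hr : 1 ≤ r)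
    (hl : l ≤ N) :
    IntegrableOn (fun p : ℝ × ℝ => eulerIntegrand N l m r τ₀ τ₁ p.1 p.2)
      (Ioo (0 : ℝ) 1 ×ˢ Ioo (0 : ℝ) 1) := by
  refine Integrable.mono' (integrableOn_pow_mul_eulerWeight_div 0)
    (Measurable.aestronglyMeasurable (by fun_prop))
    (ae_restrict_of_forall_mem (measurableSet_Ioo.prod measurableSet_Ioo) ?_)
  rintro ⟨x, t⟩ ⟨⟨hx0, hx1⟩, ht0, ht1⟩
  simp only at hx0 hx1 ht0 ht1 ⊢
  have hω := eulerWeight_nonneg ht0.le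
  have ht : 0 < 1 - t := by linarith
  have hxr : 0 ≤ 1 - x ^ r := by have := pow_le_one₀ (n := r) hx0.le hx1.le; linarith
  have hs : 0 < 1 - t + x * t := by positivity
  have hxs : x ≤ 1 - t + x * t := by nlinarith
  have h1r : (1 : ℝ) ≤ (r : ℝ) ^ N := one_le_pow₀ (by exact_mod_cast hr)
  have hnn : 0 ≤ eulerIntegrand N l m r τ₀ τ₁ x t := by
    unfold eulerIntegrand
    positivity
  rw [Real.norm_eq_abs, abs_of_nonneg hnn, pow_zero, one_mul]
  unfold eulerIntegrand
  rw [div_le_div_iff₀ (by positivity) hs]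
  have b1 : x ^ (N + τ₁ + m - 1) ≤ (1 - t + x * t) ^ l :=
    (pow_le_pow_of_le_one hx0.le hx1.le (by omega)).trans (pow_le_pow_left₀ hx0.le hxs l)
  have b2 : (1 - x ^ r) ^ N ≤ 1 := pow_le_one₀ hxr (by have := pow_pos hx0 r; linarith)
  have b3 : t ^ (N + τ₁ + m - 1 - τ₀) ≤ 1 := pow_le_one₀ ht0.le ht1.le
  have b4 : (1 - t) ^ (τ₀ + l + 1 - (N + τ₁ + m)) ≤ 1 := pow_le_one₀ ht.le (by linarith)
  calc _ ≤ (1 - t + x * t) ^ l * 1 * 1 * 1 * eulerWeight t * (1 - t + x * t) := by gcongr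
    _ = eulerWeight t * (1 * (1 - t + x * t) ^ (l + 1)) := by ring
    _ ≤ _ := by gcongr

theorem Icc_prod_Icc_ae_eq_Ioo_prod_Ioo :
    (Icc (0 : ℝ) 1 ×ˢ Icc (0 : ℝ) 1 : Set (ℝ × ℝ)) =ᵐ[volume] Ioo (0 : ℝ) 1 ×ˢ Ioo (0 : ℝ) 1 :=
  Measure.set_prod_ae_eq Ioo_ae_eq_Icc.symm Ioo_ae_eq_Icc.symm

theorem abs_setIntegral_prod_le {f g : ℝ × ℝ → ℝ} {C : ℝ}
    (hf : IntegrableOn f (Ioo (0 : ℝ) 1 ×ˢ Ioo (0 : ℝ) 1))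
    (hg : IntegrableOn g (Ioo (0 : ℝ) 1 ×ˢ Ioo (0 : ℝ) 1))
    (h : ∀ t ∈ Ioo (0 : ℝ) 1, |∫ x in (0 : ℝ)..1, f (x, t)| ≤ C * ∫ x in (0 : ℝ)..1, g (x, t)) :
    |∫ p in Ioo (0 : ℝ) 1 ×ˢ Ioo (0 : ℝ) 1, f p| ≤
      C * ∫ t in (0 : ℝ)..1, ∫ x in (0 : ℝ)..1, g (x, t) := by
  have e : ∀ F : ℝ → ℝ, ∫ x in (0 : ℝ)..1, F x = ∫ x in Ioo (0 : ℝ) 1, F x := fun F => by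
    rw [intervalIntegral.integral_of_le zero_le_one, integral_Ioc_eq_integral_Ioo]
  simp only [e] at h ⊢
  unfold IntegrableOn at hf hg
  rw [Measure.volume_eq_prod, ← Measure.prod_restrict] at hf hg ⊢
  rw [integral_prod_symm _ hf, ← integral_const_mul, ← Real.norm_eq_abs]
  exact norm_integral_le_of_norm_le (hg.integral_prod_right.const_mul C)
    (ae_restrict_of_forall_mem measurableSet_Ioo h)

end

theorem corollary3 (m : ℕ) (hm : 1 ≤ m) (n : ℕ → ℕ) (hn : ∀ j ∈ Finset.Icc 1 m, 1 ≤ n j)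
    (r : ℕ) (hr : 1 ≤ r) (τ₀ τ₁ N : ℕ) (hN : N = ∑ j ∈ Finset.Icc 1 m, n j)
    (hlow : (N : ℤ) - n m + τ₁ + (m - 1) ≤ τ₀)
    (hupp : (τ₀ : ℤ) ≤ N + τ₁ + (m - 1)) :
    MeasureTheory.IntegrableOn
        (fun p : ℝ × ℝ => eulerIntegrand N (n m) m r τ₀ τ₁ p.1 p.2)
        (Set.Icc (0 : ℝ) 1 ×ˢ Set.Icc (0 : ℝ) 1) ∧
      |Real.eulerMascheroniConstant -
          (∏ j ∈ Finset.Icc 1 m, ((n j).factorial : ℝ)) /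
              ((N.factorial : ℝ) * (-(r : ℝ)) ^ N) *
            ∑ k ∈ Finset.range (N + 1), (-1 : ℝ) ^ k * (N.choose k : ℝ) *
              (∏ j ∈ Finset.Icc 1 m,
                ((r * k + (∑ i ∈ Finset.Icc 1 j, n i) + τ₁ + (j - 1)).choose (n j) : ℝ)) *
              Real.eulerMascheroniSeq (r * k + τ₀)| ≤
        (∏ j ∈ Finset.Icc 1 (m - 1),
            ((N : ℝ) + j) / ((∑ i ∈ Finset.Icc (j + 1) m, (n i : ℝ)) + ((m : ℝ) - j))) *
          ∫ t in (0 : ℝ)..1, ∫ x in (0 : ℝ)..1, eulerIntegrand N (n m) m r τ₀ τ₁ x t := by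
  have hlN : n m ≤ N := by
    rw [hN]
    exact Finset.single_le_sum (f := n) (fun _ _ => Nat.zero_le _) (by simp; omega)
  have hint := integrableOn_eulerIntegrand τ₀ τ₁ hm hr hlN
  refine ⟨hint.congr_set_ae Icc_prod_Icc_ae_eq_Ioo_prod_Ioo, ?_⟩
  -- The exponent of the k = 0 term of U_j; the summand j - 1 counts the factors X between
  -- consecutive blocks.
  set e : ℕ → ℕ := fun j => (∑ i ∈ Finset.Icc 1 j, n i) + τ₁ + (j - 1) with he
  have he_succ : ∀ j ∈ Finset.Icc 1 m, e (j + 1) = e j + 1 + n (j + 1) := by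
    intro j hj
    have := (Finset.mem_Icc.1 hj).1
    simp only [he]
    rw [Finset.sum_Icc_succ_top (by omega)]
    omega
  have hle_sum : ∀ j ∈ Finset.Icc 1 m, n j ≤ ∑ i ∈ Finset.Icc 1 j, n i := fun j hj =>
    Finset.single_le_sum (f := n) (fun _ _ => Nat.zero_le _)
      (by have := Finset.mem_Icc.1 hj; simp; omega)
  set U := chainPoly N r m n e with hUdef
  have h0 : ∀ j ∈ Finset.Icc 1 m, X ^ n j ∣ U j := fun j hj =>
    X_pow_dvd_chainPoly N r m (by have := hle_sum j hj; simp only [he]; omega)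
  have h1 : ∀ j ∈ Finset.Icc 1 m, (X - 1) ^ n j ∣ U j := fun j hj =>
    (pow_dvd_pow _ (hle_sum j hj)).trans (X_sub_one_pow_dvd_chainPoly r hN he_succ
      (Finset.mem_Icc.1 hj).1 (Finset.mem_Icc.1 hj).2)
  have hU : ∀ j ∈ Finset.Icc 1 m, j + 1 ≤ m →
      derivative^[n (j + 1)] (U (j + 1)) = X * U j := by
    intro j hj hjm
    rw [hUdef, iterate_derivative_chainPoly N r hjm (he_succ j hj), chainPoly, Finset.mul_sum]
    refine Finset.sum_congr rfl fun k _ => ?_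
    rw [← add_assoc, pow_succ]
    ring
  have hUm : U m = X ^ (N + τ₁ + (m - 1)) * (1 - X ^ r) ^ N := by
    rw [hUdef, chainPoly_self, he, hN]
  -- This d is the exponent of t on the right; the two hypotheses on τ₀ say exactly 0 ≤ d ≤ n_m.
  obtain ⟨d, hd⟩ : ∃ d, τ₀ + d = N + τ₁ + (m - 1) := ⟨N + τ₁ + (m - 1) - τ₀, by omega⟩
  have hdl : d ≤ n m := by omega
  set a : ℕ → ℝ := fun k => (-1 : ℝ) ^ k * (N.choose k : ℝ) *
    ∏ i ∈ Finset.Icc 1 m, ((r * k + e i).descFactorial (n i) : ℝ) with ha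
  have hF : derivative^[n (0 + 1)] (U (0 + 1)) =
      ∑ k ∈ Finset.range (N + 1), C (a k) * X ^ (r * k + τ₁) := by
    rw [hUdef, iterate_derivative_chainPoly N r (a := τ₁) (by omega) (by simp [he]; omega)]
    rfl
  rw [zero_add] at hF
  have hasum : ∑ k ∈ Finset.range (N + 1), a k = N.factorial * (-(r : ℝ)) ^ N :=
    sum_alternating_prod_descFactorial r hr e hN
  have hr0 : (0 : ℝ) < r := by exact_mod_cast hr
  have hD : (N.factorial : ℝ) * (-(r : ℝ)) ^ N ≠ 0 :=
    mul_ne_zero (by positivity) (pow_ne_zero _ (neg_ne_zero.2 hr0.ne'))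
  set f : ℝ × ℝ → ℝ := fun p => (derivative^[n 1] (U 1)).eval p.1 * p.1 ^ (N + (m - 1) - d) *
        (eulerWeight p.2 / (1 - p.2 + p.1 * p.2)) with hf
  have hfsum : f = fun p => ∑ k ∈ Finset.range (N + 1),
      a k * (p.1 ^ (r * k + τ₀) * (eulerWeight p.2 / (1 - p.2 + p.1 * p.2))) := by
    funext p
    simp only [hf, hF, eval_finsetSum, eval_mul, eval_C, eval_pow, eval_X]
    rw [Finset.sum_mul, Finset.sum_mul]
    refine Finset.sum_congr rfl fun k _ => ?_
    -- The power of x split off is A = N + (m-1) - d = τ₀ - τ₁.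
    rw [show r * k + τ₀ = r * k + τ₁ + (N + (m - 1) - d) by omega, pow_add _ (r * k + τ₁)]
    ring
  have hterm : ∀ k ∈ Finset.range (N + 1), MeasureTheory.IntegrableOn (fun p : ℝ × ℝ =>
      a k * (p.1 ^ (r * k + τ₀) * (eulerWeight p.2 / (1 - p.2 + p.1 * p.2))))
      (Set.Ioo (0 : ℝ) 1 ×ˢ Set.Ioo (0 : ℝ) 1) := fun k _ =>
    (integrableOn_pow_mul_eulerWeight_div (r * k + τ₀)).const_mul (a k)
  have hfint : MeasureTheory.IntegrableOn f (Set.Ioo (0 : ℝ) 1 ×ˢ Set.Ioo (0 : ℝ) 1) := by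
    rw [hfsum]
    exact MeasureTheory.integrable_finsetSum _ hterm
  have hfval : ∫ p in Set.Ioo (0 : ℝ) 1 ×ˢ Set.Ioo (0 : ℝ) 1, f p =
      ∑ k ∈ Finset.range (N + 1), a k *
        (Real.eulerMascheroniConstant - Real.eulerMascheroniSeq (r * k + τ₀)) := by
    rw [hfsum, MeasureTheory.integral_finsetSum _ hterm]
    refine Finset.sum_congr rfl fun k _ => ?_
    rw [MeasureTheory.integral_const_mul, integral_pow_mul_eulerWeight_div]
  have hchoose : ∀ k, (∏ j ∈ Finset.Icc 1 m, ((n j).factorial : ℝ)) *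
      ((-1 : ℝ) ^ k * (N.choose k : ℝ) * ∏ j ∈ Finset.Icc 1 m,
        ((r * k + (∑ i ∈ Finset.Icc 1 j, n i) + τ₁ + (j - 1)).choose (n j) : ℝ)) = a k := by
    intro k
    rw [mul_left_comm, ← Finset.prod_mul_distrib]
    simp only [ha]
    congr 1
    refine Finset.prod_congr rfl fun j _ => ?_
    rw [← Nat.cast_mul, ← Nat.descFactorial_eq_factorial_mul_choose]
    simp only [he, add_assoc]
  have hlhs : Real.eulerMascheroniConstant -
      (∏ j ∈ Finset.Icc 1 m, ((n j).factorial : ℝ)) / ((N.factorial : ℝ) * (-(r : ℝ)) ^ N) *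
        ∑ k ∈ Finset.range (N + 1), (-1 : ℝ) ^ k * (N.choose k : ℝ) *
          (∏ j ∈ Finset.Icc 1 m,
            ((r * k + (∑ i ∈ Finset.Icc 1 j, n i) + τ₁ + (j - 1)).choose (n j) : ℝ)) *
          Real.eulerMascheroniSeq (r * k + τ₀) =
      (∫ p in Set.Ioo (0 : ℝ) 1 ×ˢ Set.Ioo (0 : ℝ) 1, f p) /
        ((N.factorial : ℝ) * (-(r : ℝ)) ^ N) := by
    rw [hfval, eq_div_iff hD]
    simp only [mul_sub, Finset.sum_sub_distrib]
    rw [← Finset.sum_mul, hasum, sub_mul, mul_comm Real.eulerMascheroniConstant]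
    congr 1
    rw [div_mul_eq_mul_div, div_mul_cancel₀ _ hD, Finset.mul_sum]
    refine Finset.sum_congr rfl fun k _ => ?_
    rw [← hchoose k]
    ring
  rw [hlhs, abs_div, abs_mul, abs_pow, abs_neg, abs_of_pos hr0, Nat.abs_cast,
    div_le_iff₀ (by positivity)]
  refine (abs_setIntegral_prod_le hfint hint fun t ht =>
    abs_integral_derivative_chain_le hm hr hN hdl hd h0 h1 hU hUm ht.1 ht.2).trans (le_of_eq ?_)
  rw [Finset.prod_div_distrib, ← factorial_mul_prod_Icc_add]
  ring
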